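/- Let $d\ge 1$, $g\ge 0$, $r\ge 1$ be integers and let $\lambda^1,\dots,\lambda^r$ be partitions of $d$. For a partition $\lambda=(\lambda_1,\dots,\lambda_\ell)$ put $\iota(\lambda)=\sum_j(\lambda_j-1)$. Assume the Riemann–Hurwitz formula $\sum_{i=1}^r\iota(\lambda^i)=2d-2+2g$. A Hurwitz factorization of type $(d,r,g;\lambda^1,\dots,\lambda^r)$ is a tuple $(\sigma_1,\dots,\sigma_r)$ of permutations in $S_d$ such that (a) $\sigma_i$ has cycle type $\lambda^i$ (fixed points counted as cycles of length $1$) for every $i$; (b) $\sigma_1\cdots\sigma_r=1$; (c) $\sigma_1,\dots,\sigma_r$ generate a transitive subgroup of $S_d$. The Hurwitz number $h(d,r,g;\lambda^1,\dots,\lambda^r)$ is the number of such factorizations divided by $d!$. For integers $2\le e_i\le d$, write $h(d,r,g;e_1,\dots,e_r)$ for the Hurwitz number with $\lambda^i=(e_i,1,\dots,1)$ for every $i$ (the pure-cycle Hurwitz number). Theorem. Let $d\ge 2$ and $r\ge 1$ be integers and let $e_1,\dots,e_{r-1}\ge 2$ be integers with $$\sum_{i=1}^{r-1}(e_i-1)=d-1$$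 (so that every $e_i\le d$ and the Riemann–Hurwitz formula holds with $g=0$ and $e_r=d$). Then $$h(d,r,0;e_1,\dots,e_{r-1},d)=d^{\,r-3}.$$ -/

import Mathlib

open scoped Nat

/-- The index `ι(λ) = ∑ᵢ (λᵢ - 1)` of a partition (all parts are at least `1`). -/
def partitionIndex {d : ℕ} (lam : d.Partition) : ℕ :=
  (lam.parts.map fun k => k - 1).sum

/-- `σ` is a Hurwitz factorization of type `(d, r, g; λ¹, …, λʳ)`. The Riemann-Hurwitz formula
`∑ ι(λⁱ) = 2d - 2 + 2g`, which is the only place where the genus enters, is part of the notion. -/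
structure IsHurwitzFactorization (d r g : ℕ) (lam : Fin r → d.Partition)
    (σ : Fin r → Equiv.Perm (Fin d)) : Prop where
  riemann_hurwitz : (∑ i, (partitionIndex (lam i) : ℤ)) = 2 * (d : ℤ) - 2 + 2 * (g : ℤ)
  /-- `Equiv.Perm.partition` lists the lengths of all cycles, fixed points included. -/
  cycle_type : ∀ i, (σ i).partition.parts = (lam i).parts
  /-- The ordered product `σ₁ σ₂ ⋯ σᵣ` is the identity. -/
  prod_eq_one : (List.ofFn σ).prod = 1
  transitive : MulAction.IsPretransitive (Subgroup.closure (Set.range σ)) (Fin d)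

/-- The Hurwitz number `h(d, r, g; λ¹, …, λʳ)`: the number of Hurwitz factorizations of this type,
divided by `d!`. -/
noncomputable def hurwitzNumber (d r g : ℕ) (lam : Fin r → d.Partition) : ℚ :=
  (Nat.card {σ : Fin r → Equiv.Perm (Fin d) // IsHurwitzFactorization d r g lam σ} : ℚ) / (d ! : ℚ)

/-- The partition `(e, 1, …, 1)` of `d`, for `2 ≤ e ≤ d`. -/
def pureCyclePartition (d e : ℕ) (he : 2 ≤ e ∧ e ≤ d) : d.Partition where
  parts := e ::ₘ Multiset.replicate (d - e) 1
  parts_pos := by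
    intro i hi
    rcases Multiset.mem_cons.mp hi with h | h
    · omega
    · have := Multiset.eq_of_mem_replicate h
      omega
  parts_sum := by
    rw [Multiset.sum_cons, Multiset.sum_replicate, smul_eq_mul]
    omega

/-- The pure-cycle Hurwitz number `h(d, r, g; e₁, …, eᵣ)`. -/
noncomputable def pureCycleHurwitzNumber (d r g : ℕ) (e : Fin r → ℕ)
    (he : ∀ i, 2 ≤ e i ∧ e i ≤ d) : ℚ :=
  hurwitzNumber d r g fun i => pureCyclePartition d (e i) (he i)

/-!
Since the last permutation is a `d`-cycle determined by the others, the factorizations correspond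
to the tuples of cycles `σ₁, …, σₙ` of lengths `e₁, …, eₙ` in the symmetric group whose product is
a `d`-cycle, and it has to be shown that there are `(d - 1)! d ^ (n - 1)` of these.

Multiplying `π` by a transposition `(x y)` merges the cycles of `π` through `x` and `y` if these
are different (`cycleSet_mul_swap_right`, `cycleSets_mul_swap_erase`), and otherwise it does not
lower the number of cycles (`card_cycleSets_le_mul_swap`). So a cycle of length `e` lowers this
number by at most `e - 1`, with equality only if its `e` points lie in different cycles of `π`,
which it then unites (`merge_formPerm`). As `∑ (eᵢ - 1) = d - 1`, each factor of a product that is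
a `d`-cycle has to lower the number by exactly `eᵢ - 1`.

The count is by induction on the number of factors, for products `π σ₁ ⋯ σₙ` with an arbitrary
initial permutation `π`. If `π` has `k = 1 + ∑ (eᵢ - 1)` cycles and `P(π)` is the product of their
lengths, then the number of tuples with `π σ₁ ⋯ σₙ` a `d`-cycle is `P(π) d ^ (n - 1) (k - 1)!`
(`sum_mul_prod_ofFn`). The inductive step needs the sum of `P(π σ)` over all cycles `σ` of length
`e` that merge `e` cycles of `π` (`sum_cycleProd_mul_cycle`). The merged cycle has length
`∑ |C(x)|`, over the points `x` of `σ`, where `C(x)` is the cycle of `π` through `x`. So this sum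
is one over pairs `(σ, x)`, that is, over lists `x, y₁, …, y₍ₑ₋₁₎`, of `P(π) / ∏ |C(yᵢ)|`. When the
`yᵢ` are chosen one after the other, the sum of `1 / |C(yᵢ)|` over all admissible `yᵢ` is the number
of cycles not merged yet; this makes it `d P(π) (k - 1) (k - 2) ⋯ (k - e + 1)`
(`sum_cycleProdErase_mul_formPerm`).
-/

open Equiv Equiv.Perm Finset

/-! ### Cycles of a permutation as sets -/

section Cycles

/-- The cycle relation is contained in every equivalence relation that relates each point to its
image. -/
theorem Equiv.Perm.SameCycle.rel_of_forall {α : Type*} [Finite α] {f : Perm α}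
    {r : α → α → Prop} (hr : Equivalence r) (h : ∀ z, r z (f z)) {x y : α}
    (hxy : f.SameCycle x y) : r x y := by
  obtain ⟨i, -, rfl⟩ := hxy.exists_pow_eq'
  clear hxy
  induction i with
  | zero => exact hr.refl x
  | succ i ih =>
    rw [pow_succ', mul_apply]
    exact hr.trans ih (h _)

variable {α : Type*} [Fintype α] [DecidableEq α]

/-- The set of points in the cycle of `π` through `x`; it is `{x}` if `x` is a fixed point. -/
def cycleSet (π : Perm α) (x : α) : Finset α := {y | π.SameCycle x y}

/-- The set of all cycles of `π` (fixed points included), each given by its set of points. -/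
def cycleSets (π : Perm α) : Finset (Finset α) := univ.image (cycleSet π)

/-- The product of the lengths of all cycles of `π`. -/
def cycleProd (π : Perm α) : ℚ := ∏ C ∈ cycleSets π, (#C : ℚ)

/-- The product of the lengths of all cycles of `π` other than the one through `x`. -/
def cycleProdErase (π : Perm α) (x : α) : ℚ := ∏ C ∈ (cycleSets π).erase (cycleSet π x), (#C : ℚ)

theorem mem_cycleSet {π : Perm α} {x y : α} : y ∈ cycleSet π x ↔ π.SameCycle x y := by
  simp [cycleSet]

theorem cycleSet_eq_iff {π : Perm α} {x y : α} :
    cycleSet π x = cycleSet π y ↔ π.SameCycle x y := by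
  constructor
  · intro h
    rw [← mem_cycleSet, h, mem_cycleSet]
  · intro h
    ext z
    rw [mem_cycleSet, mem_cycleSet]
    exact ⟨fun k => h.symm.trans k, fun k => h.trans k⟩

theorem cycleSet_mem_cycleSets (π : Perm α) (x : α) : cycleSet π x ∈ cycleSets π :=
  mem_image_of_mem _ (mem_univ x)

theorem card_cycleSet_pos (π : Perm α) (x : α) : 0 < #(cycleSet π x) :=
  card_pos.mpr ⟨x, mem_cycleSet.mpr (SameCycle.refl _ _)⟩

theorem card_mul_cycleProdErase (π : Perm α) (x : α) :
    (#(cycleSet π x) : ℚ) * cycleProdErase π x = cycleProd π :=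
  mul_prod_erase _ (fun C : Finset α => (#C : ℚ)) (cycleSet_mem_cycleSets π x)

theorem cycleProdErase_congr {π : Perm α} {x y : α} (h : π.SameCycle x y) :
    cycleProdErase π x = cycleProdErase π y := by
  rw [cycleProdErase, cycleProdErase, cycleSet_eq_iff.mpr h]

theorem cycleSet_one (x : α) : cycleSet (1 : Perm α) x = {x} := by
  ext y
  simp [mem_cycleSet, sameCycle_one, eq_comm]

theorem card_cycleSets_one : #(cycleSets (1 : Perm α)) = Fintype.card α := by
  rw [cycleSets, card_image_of_injective, card_univ]
  intro x y h
  simpa [cycleSet_one] using h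

theorem cycleProd_one : cycleProd (1 : Perm α) = 1 := by
  refine prod_eq_one fun C hC => ?_
  obtain ⟨x, -, rfl⟩ := mem_image.mp hC
  simp [cycleSet_one]

theorem card_cycleSets_eq_one_iff [Nonempty α] {π : Perm α} :
    #(cycleSets π) = 1 ↔ ∀ x y, π.SameCycle x y := by
  constructor
  · intro h x y
    rw [← cycleSet_eq_iff]
    exact card_le_one.mp h.le _ (cycleSet_mem_cycleSets π x) _ (cycleSet_mem_cycleSets π y)
  · intro h
    refine le_antisymm (card_le_one.mpr ?_) (card_pos.mpr ⟨_, cycleSet_mem_cycleSets π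
      (Classical.arbitrary α)⟩)
    intro C hC D hD
    obtain ⟨x, -, rfl⟩ := mem_image.mp hC
    obtain ⟨y, -, rfl⟩ := mem_image.mp hD
    exact cycleSet_eq_iff.mpr (h x y)

theorem cycleProd_of_card_cycleSets_eq_one {π : Perm α} (h : #(cycleSets π) = 1) :
    cycleProd π = Fintype.card α := by
  obtain ⟨C, hC⟩ := card_eq_one.mp h
  obtain ⟨x, -, -⟩ := mem_image.mp (hC ▸ mem_singleton_self C : C ∈ cycleSets π)
  have : Nonempty α := ⟨x⟩
  have hx : cycleSet π x = univ := by
    ext y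
    simp [mem_cycleSet, card_cycleSets_eq_one_iff.mp h x y]
  have h1 : cycleSets π = {univ} := by
    have h2 := cycleSet_mem_cycleSets π x
    rw [hC, mem_singleton, hx] at h2
    rw [hC, h2]
  rw [cycleProd, h1, prod_singleton, card_univ]

/-- Every cycle other than the one through `x` contributes `1` to the sum. -/
theorem sum_inv_card_cycleSet (π : Perm α) (x : α) :
    ∑ y, (if π.SameCycle x y then 0 else (#(cycleSet π y) : ℚ)⁻¹) = (#(cycleSets π) - 1 : ℕ) := by
  have key : ∀ C ∈ cycleSets π,
      (∑ y with cycleSet π y = C, (if π.SameCycle x y then 0 else (#(cycleSet π y) : ℚ)⁻¹)) =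
        if cycleSet π x = C then 0 else 1 := by
    intro C hC
    obtain ⟨z, -, rfl⟩ := mem_image.mp hC
    have hfil : ({y | cycleSet π y = cycleSet π z} : Finset α) = cycleSet π z := by
      ext y
      simp [mem_cycleSet, cycleSet_eq_iff, sameCycle_comm]
    rw [hfil]
    have : ∀ y ∈ cycleSet π z, (if π.SameCycle x y then 0 else (#(cycleSet π y) : ℚ)⁻¹) =
        if cycleSet π x = cycleSet π z then 0 else (#(cycleSet π z) : ℚ)⁻¹ := by
      intro y hy
      rw [cycleSet_eq_iff.mpr (mem_cycleSet.mp hy)]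
      simp only [cycleSet_eq_iff]
    rw [sum_congr rfl this, sum_const, nsmul_eq_mul]
    have := card_cycleSet_pos π z
    split_ifs
    · simp
    · field_simp
  rw [← sum_fiberwise_of_maps_to (fun y _ => cycleSet_mem_cycleSets π y), sum_congr rfl key,
    sum_ite, sum_const_zero, zero_add, sum_const, nsmul_one, filter_ne,
    card_erase_of_mem (cycleSet_mem_cycleSets π x)]

/-! ### Multiplication by a transposition -/

theorem sameCycle_of_sameCycle_mul_swap {π : Perm α} {x y : α} (h : π.SameCycle x y) {z w : α}
    (hzw : (π * swap x y).SameCycle z w) : π.SameCycle z w := by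
  refine hzw.rel_of_forall (SameCycle.equivalence π) fun u => ?_
  rw [mul_apply, sameCycle_apply_right]
  by_cases hx : u = x
  · rwa [hx, swap_apply_left]
  by_cases hy : u = y
  · rw [hy, swap_apply_right]; exact h.symm
  rw [swap_apply_of_ne_of_ne hx hy]

/-- Multiplying by a transposition inside a cycle refines the cycles. -/
theorem card_cycleSets_le_mul_swap {π : Perm α} {x y : α} (h : π.SameCycle x y) :
    #(cycleSets π) ≤ #(cycleSets (π * swap x y)) := by
  have : cycleSets π ⊆ (cycleSets (π * swap x y)).image (fun C => C.biUnion (cycleSet π)) := by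
    intro C hC
    obtain ⟨z, -, rfl⟩ := mem_image.mp hC
    refine mem_image.mpr ⟨cycleSet (π * swap x y) z, cycleSet_mem_cycleSets _ _, ?_⟩
    ext w
    simp only [mem_biUnion, mem_cycleSet]
    exact ⟨fun ⟨u, hu, huw⟩ => (sameCycle_of_sameCycle_mul_swap h hu).trans huw,
      fun hw => ⟨z, SameCycle.refl _ _, hw⟩⟩
  exact (card_le_card this).trans card_image_le

theorem sameCycle_mul_swap_self {π : Perm α} {x y : α} (h : ¬ π.SameCycle x y) :
    (π * swap x y).SameCycle x y := by
  have hn : 0 < Function.minimalPeriod π y :=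
    Function.minimalPeriod_pos_of_mem_periodicPts
      (Function.mem_periodicPts.mpr ⟨orderOf π, orderOf_pos π, by
        rw [Function.IsPeriodicPt, Function.IsFixedPt, ← coe_pow, pow_orderOf_eq_one, coe_one, id]⟩)
  -- The cycle of `x` under the product runs through `π y, π² y, …` until it reaches `y`.
  have key : ∀ j, j + 1 ≤ Function.minimalPeriod π y →
      ((π * swap x y) ^ (j + 1)) x = (π ^ (j + 1)) y := by
    intro j
    induction j with
    | zero => intro _; simp
    | succ j ih =>
      intro hj
      rw [pow_succ', mul_apply, ih (by omega), mul_apply, swap_apply_of_ne_of_ne, ← mul_apply,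
        ← pow_succ']
      · intro hx
        exact h (SameCycle.symm ⟨(j + 1 : ℕ), by rw [zpow_natCast, hx]⟩)
      · intro hy
        refine Function.not_isPeriodicPt_of_pos_of_lt_minimalPeriod (f := π) (x := y)
          (n := j + 1) (by omega) (by omega) ?_
        rwa [Function.IsPeriodicPt, Function.IsFixedPt, ← coe_pow]
  obtain ⟨j, hj⟩ := Nat.exists_eq_succ_of_ne_zero hn.ne'
  refine ⟨(j + 1 : ℕ), ?_⟩
  rw [zpow_natCast, key j hj.ge]
  have := Function.isPeriodicPt_minimalPeriod π y
  rw [hj] at this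
  rwa [Function.IsPeriodicPt, Function.IsFixedPt, ← coe_pow] at this

theorem Equiv.Perm.SameCycle.mul_swap {π : Perm α} {x y : α} (h : ¬ π.SameCycle x y) {z w : α}
    (hzw : π.SameCycle z w) : (π * swap x y).SameCycle z w := by
  have hxy := sameCycle_mul_swap_self h
  refine hzw.rel_of_forall (SameCycle.equivalence _) fun u => ?_
  have e : π u = (π * swap x y) (swap x y u) := by simp
  rw [e, sameCycle_apply_right]
  by_cases hx : u = x
  · rwa [hx, swap_apply_left]
  by_cases hy : u = y
  · rw [hy, swap_apply_right]; exact hxy.symm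
  rw [swap_apply_of_ne_of_ne hx hy]

theorem cycleSet_mul_swap_of_not {π : Perm α} {x y z : α} (h : ¬ π.SameCycle x y)
    (hx : ¬ π.SameCycle x z) (hy : ¬ π.SameCycle y z) :
    cycleSet (π * swap x y) z = cycleSet π z := by
  ext w
  rw [mem_cycleSet, mem_cycleSet]
  refine ⟨fun hw => ?_, fun hw => SameCycle.mul_swap h hw⟩
  let r : Setoid α :=
    { r := fun a b => π.SameCycle z a ∧ π.SameCycle z b ∨ ¬ π.SameCycle z a ∧ ¬ π.SameCycle z b
      iseqv := ⟨fun a => by tauto, fun {a b} => by tauto, fun {a b c} => by tauto⟩ }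
  have : r.r z w := by
    refine hw.rel_of_forall r.iseqv fun u => ?_
    change π.SameCycle z u ∧ π.SameCycle z _ ∨ ¬ π.SameCycle z u ∧ ¬ π.SameCycle z _
    rw [mul_apply, sameCycle_apply_right]
    rw [sameCycle_comm] at hx hy
    by_cases hux : u = x
    · rw [hux, swap_apply_left]; tauto
    by_cases huy : u = y
    · rw [huy, swap_apply_right]; tauto
    rw [swap_apply_of_ne_of_ne hux huy]; tauto
  have hz := SameCycle.refl π z
  rcases this with h1 | h1
  · exact h1.2
  · exact absurd hz h1.1

theorem cycleSet_mul_swap_right {π : Perm α} {x y : α} (h : ¬ π.SameCycle x y) :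
    cycleSet (π * swap x y) y = cycleSet π x ∪ cycleSet π y := by
  have hxy := sameCycle_mul_swap_self h
  ext w
  rw [mem_union]
  constructor
  · intro hw
    by_contra! hcon
    rw [mem_cycleSet, mem_cycleSet] at hcon
    have := cycleSet_mul_swap_of_not h hcon.1 hcon.2
    rw [mem_cycleSet] at hw
    have h2 : y ∈ cycleSet (π * swap x y) w := mem_cycleSet.mpr hw.symm
    rw [this, mem_cycleSet] at h2
    exact hcon.2 h2.symm
  · rw [mem_cycleSet, mem_cycleSet, mem_cycleSet]
    rintro (hw | hw)
    · exact hxy.symm.trans (SameCycle.mul_swap h hw)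
    · exact SameCycle.mul_swap h hw

theorem disjoint_cycleSet {π : Perm α} {x y : α} (h : ¬ π.SameCycle x y) :
    Disjoint (cycleSet π x) (cycleSet π y) := by
  rw [Finset.disjoint_left]
  intro z hz hz'
  rw [mem_cycleSet] at hz hz'
  exact h (hz.trans hz'.symm)

theorem card_cycleSet_mul_swap_right {π : Perm α} {x y : α} (h : ¬ π.SameCycle x y) :
    #(cycleSet (π * swap x y) y) = #(cycleSet π x) + #(cycleSet π y) := by
  rw [cycleSet_mul_swap_right h, card_union_of_disjoint (disjoint_cycleSet h)]

/-- Apart from the merged cycle, `π * swap x y` has the same cycles as `π`. -/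
theorem cycleSets_mul_swap_erase {π : Perm α} {x y : α} (h : ¬ π.SameCycle x y) :
    (cycleSets (π * swap x y)).erase (cycleSet (π * swap x y) y) =
      ((cycleSets π).erase (cycleSet π x)).erase (cycleSet π y) := by
  have hxy := sameCycle_mul_swap_self h
  have key : ∀ z, ¬ (π * swap x y).SameCycle y z ↔ ¬ π.SameCycle x z ∧ ¬ π.SameCycle y z := by
    intro z
    rw [← mem_cycleSet, cycleSet_mul_swap_right h, mem_union, mem_cycleSet, mem_cycleSet, not_or]
  ext C
  simp only [mem_erase]
  constructor
  · rintro ⟨hC, hC'⟩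
    obtain ⟨z, -, rfl⟩ := mem_image.mp hC'
    rw [Ne, eq_comm, cycleSet_eq_iff, key] at hC
    rw [cycleSet_mul_swap_of_not h hC.1 hC.2]
    refine ⟨?_, ?_, cycleSet_mem_cycleSets _ _⟩
    · rw [Ne, eq_comm, cycleSet_eq_iff]; exact hC.2
    · rw [Ne, eq_comm, cycleSet_eq_iff]; exact hC.1
  · rintro ⟨hy, hx, hC⟩
    obtain ⟨z, -, rfl⟩ := mem_image.mp hC
    rw [Ne, eq_comm, cycleSet_eq_iff] at hx hy
    rw [← cycleSet_mul_swap_of_not h hx hy]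
    refine ⟨?_, cycleSet_mem_cycleSets _ _⟩
    rw [Ne, eq_comm, cycleSet_eq_iff, key]
    exact ⟨hx, hy⟩

theorem cycleSet_mem_erase {π : Perm α} {x y : α} (h : ¬ π.SameCycle x y) :
    cycleSet π y ∈ (cycleSets π).erase (cycleSet π x) := by
  refine mem_erase.mpr ⟨?_, cycleSet_mem_cycleSets _ _⟩
  rw [Ne, eq_comm, cycleSet_eq_iff]
  exact h

theorem card_cycleSets_mul_swap {π : Perm α} {x y : α} (h : ¬ π.SameCycle x y) :
    #(cycleSets (π * swap x y)) + 1 = #(cycleSets π) := by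
  have h1 := congrArg card (cycleSets_mul_swap_erase h)
  have h2 := card_erase_add_one (cycleSet_mem_cycleSets (π * swap x y) y)
  have h3 := card_erase_add_one (cycleSet_mem_cycleSets π x)
  have h4 := card_erase_add_one (cycleSet_mem_erase h)
  omega

theorem cycleProdErase_mul_swap {π : Perm α} {x y : α} (h : ¬ π.SameCycle x y) :
    cycleProdErase (π * swap x y) y = cycleProdErase π x * (#(cycleSet π y) : ℚ)⁻¹ := by
  rw [cycleProdErase, cycleProdErase, cycleSets_mul_swap_erase h,
    ← mul_prod_erase _ _ (cycleSet_mem_erase h)]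
  have := card_cycleSet_pos π y
  field_simp

end Cycles

section Lists

variable {α : Type*} [Fintype α] [DecidableEq α]

/-! ### Multiplication by a cycle given as a list -/

/-- The cycle `(x, l₁, l₂, …)` is the product of the transpositions `(x l₁)`, `(l₁ l₂)`, …; this
also holds by definition if the list has repetitions. Each of them merges at most two cycles. -/
theorem card_cycleSets_le_mul_formPerm (π : Perm α) (x : α) (l : List α) :
    #(cycleSets π) ≤ #(cycleSets (π * (x :: l).formPerm)) + l.length := by
  induction l generalizing π x with
  | nil => simp
  | cons y l ih =>
    rw [List.formPerm_cons_cons, ← mul_assoc, List.length_cons]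
    have h1 := ih (π * swap x y) y
    by_cases h : π.SameCycle x y
    · have := card_cycleSets_le_mul_swap h
      omega
    · have := card_cycleSets_mul_swap h
      omega

/-- If the product with a list of transpositions merges as many cycles as possible, then already
its first transposition merges two cycles, and so do the remaining ones. -/
theorem card_cycleSets_mul_formPerm_cons_iff (π : Perm α) (x y : α) (l : List α) :
    #(cycleSets (π * (x :: y :: l).formPerm)) + (l.length + 1) = #(cycleSets π) ↔
      ¬ π.SameCycle x y ∧ #(cycleSets (π * swap x y * (y :: l).formPerm)) + l.length =
        #(cycleSets (π * swap x y)) := by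
  rw [List.formPerm_cons_cons, ← mul_assoc]
  have h1 := card_cycleSets_le_mul_formPerm (π * swap x y) y l
  by_cases h : π.SameCycle x y
  · have := card_cycleSets_le_mul_swap h
    simp only [h, not_true, false_and, iff_false]
    omega
  · have := card_cycleSets_mul_swap h
    simp only [h, not_false_eq_true, true_and]
    omega

/-- If multiplication by the cycle `(x, l₁, l₂, …)` merges as many cycles of `π` as possible, then
its entries lie in pairwise different cycles of `π`, and these are united to a single cycle. -/
theorem merge_formPerm (π : Perm α) (x : α) (l : List α)
    (h : #(cycleSets (π * (x :: l).formPerm)) + l.length = #(cycleSets π)) :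
    (x :: l).Nodup ∧ (∀ z ∈ l, ¬ π.SameCycle x z) ∧
      (∀ z ∈ l, (π * (x :: l).formPerm).SameCycle x z) ∧
      (∀ z w, π.SameCycle z w → (π * (x :: l).formPerm).SameCycle z w) ∧
      #(cycleSet (π * (x :: l).formPerm) x) = ((x :: l).map fun z => #(cycleSet π z)).sum := by
  induction l generalizing π x with
  | nil => simp
  | cons y l ih =>
    rw [List.length_cons, card_cycleSets_mul_formPerm_cons_iff] at h
    obtain ⟨hxy, h⟩ := h
    obtain ⟨hnd, hns, hs, hmono, hsum⟩ := ih _ _ h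
    have hxy' := sameCycle_mul_swap_self hxy
    have hns' : ∀ z ∈ l, ¬ π.SameCycle x z ∧ ¬ π.SameCycle y z := fun z hz =>
      ⟨fun hc => hns z hz (hxy'.symm.trans (SameCycle.mul_swap hxy hc)),
        fun hc => hns z hz (SameCycle.mul_swap hxy hc)⟩
    rw [List.formPerm_cons_cons, ← mul_assoc]
    have hxyρ := hmono _ _ hxy'
    refine ⟨List.nodup_cons.mpr ⟨?_, hnd⟩, ?_, ?_, ?_, ?_⟩
    · rw [List.mem_cons, not_or]
      refine ⟨fun hc => hxy (hc ▸ SameCycle.refl _ _), fun hc => (hns' x hc).1 (SameCycle.refl _ _)⟩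
    · rw [List.forall_mem_cons]
      exact ⟨hxy, fun z hz => (hns' z hz).1⟩
    · rw [List.forall_mem_cons]
      exact ⟨hxyρ, fun z hz => hxyρ.trans (hs z hz)⟩
    · exact fun z w hzw => hmono _ _ (SameCycle.mul_swap hxy hzw)
    · rw [cycleSet_eq_iff.mpr hxyρ, hsum, List.map_cons, List.sum_cons, List.map_cons,
        List.sum_cons, List.map_cons, List.sum_cons, card_cycleSet_mul_swap_right hxy, add_assoc]
      congr 2
      congr 1
      refine List.map_congr_left fun z hz => ?_
      rw [cycleSet_mul_swap_of_not hxy (hns' z hz).1 (hns' z hz).2]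

/-- Sum over all ways to merge the cycle through `x` with `j` further cycles. The entries of the
list are chosen one after the other: each choice of a cycle to merge contributes its length many
entries, and this is the factor by which `cycleProdErase` drops. -/
theorem sum_cycleProdErase_mul_formPerm (j : ℕ) (π : Perm α) (x : α) :
    ∑ l : Fin j → α, (if #(cycleSets (π * (x :: List.ofFn l).formPerm)) + j = #(cycleSets π) then
        cycleProdErase (π * (x :: List.ofFn l).formPerm) x else 0) =
      cycleProdErase π x * ((#(cycleSets π) - 1).descFactorial j : ℕ) := by
  induction j generalizing π x with
  | zero => simp
  | succ j ih =>
    rw [← (Fin.consEquiv fun _ : Fin (j + 1) => α).sum_comp, Fintype.sum_prod_type]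
    have key : ∀ y : α, (∑ l : Fin j → α,
        (if #(cycleSets (π * (x :: List.ofFn (Fin.consEquiv (fun _ : Fin (j + 1) => α)
            (y, l))).formPerm)) + (j + 1) = #(cycleSets π) then
          cycleProdErase (π * (x :: List.ofFn (Fin.consEquiv (fun _ : Fin (j + 1) => α)
            (y, l))).formPerm) x else 0)) =
        (if π.SameCycle x y then 0 else (#(cycleSet π y) : ℚ)⁻¹) *
          (cycleProdErase π x * ((#(cycleSets π) - 2).descFactorial j : ℕ)) := by
      intro y
      have e : ∀ l : Fin j → α, List.ofFn (Fin.consEquiv (fun _ : Fin (j + 1) => α) (y, l)) =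
          y :: List.ofFn l := fun l => by
        simp [Fin.consEquiv, List.ofFn_succ]
      simp only [e]
      by_cases h : π.SameCycle x y
      · rw [if_pos h, zero_mul]
        refine sum_eq_zero fun l _ => if_neg fun hc => ?_
        have := (card_cycleSets_mul_formPerm_cons_iff π x y (List.ofFn l)).mp
          (by rwa [List.length_ofFn])
        exact this.1 h
      · have hk := card_cycleSets_mul_swap h
        have hk' : #(cycleSets (π * swap x y)) - 1 = #(cycleSets π) - 2 := by omega
        rw [if_neg h, ← mul_assoc, mul_comm (_⁻¹), ← cycleProdErase_mul_swap h, ← hk', ← ih]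
        refine sum_congr rfl fun l _ => ?_
        have hiff := card_cycleSets_mul_formPerm_cons_iff π x y (List.ofFn l)
        rw [List.length_ofFn] at hiff
        simp only [hiff, h, not_false_eq_true, true_and]
        refine if_ctx_congr Iff.rfl (fun hc => ?_) fun _ => rfl
        have hm := merge_formPerm π x (y :: List.ofFn l)
          (by rw [List.length_cons, List.length_ofFn]; exact hiff.mpr ⟨h, hc⟩)
        rw [cycleProdErase_congr (hm.2.2.1 y List.mem_cons_self), List.formPerm_cons_cons,
          mul_assoc]
    rw [sum_congr rfl fun y _ => key y, ← sum_mul, sum_inv_card_cycleSet]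
    -- The recursion of `descFactorial` needs `#(cycleSets π) - 1` as a successor; if `π` has a
    -- single cycle, both sides vanish.
    rcases Nat.eq_zero_or_pos (#(cycleSets π) - 1) with h0 | h0
    · simp [h0]
    · obtain ⟨k, hk⟩ := Nat.exists_eq_succ_of_ne_zero h0.ne'
      have : #(cycleSets π) - 2 = k := by omega
      rw [hk, this, Nat.succ_descFactorial_succ]
      push_cast
      ring

/-! ### Multiplication by all cycles of a given length -/

open scoped Classical in
/-- The set of all cycles of length `e` in the symmetric group; meaningful for `2 ≤ e`. -/
noncomputable def cyclesOfLength (α : Type*) [Fintype α] [DecidableEq α] (e : ℕ) :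
    Finset (Perm α) :=
  {σ | σ.IsCycle ∧ #σ.support = e}

theorem mem_cyclesOfLength {e : ℕ} {σ : Perm α} :
    σ ∈ cyclesOfLength α e ↔ σ.IsCycle ∧ #σ.support = e := by
  simp [cyclesOfLength]

theorem exists_formPerm_eq_of_mem_cyclesOfLength {j : ℕ} {σ : Perm α}
    (hσ : σ ∈ cyclesOfLength α (j + 1)) {x : α} (hx : x ∈ σ.support) :
    ∃ t : List α, t.length = j ∧ (x :: t).Nodup ∧ (x :: t).formPerm = σ := by
  obtain ⟨hc, hcard⟩ := mem_cyclesOfLength.mp hσ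
  have hcyc : σ.cycleOf x = σ := hc.cycleOf_eq (mem_support.mp hx)
  have hlen : (σ.toList x).length = j + 1 := by rw [Equiv.Perm.length_toList, hcyc, hcard]
  have h0 := toList_getElem_zero σ x hx
  obtain ⟨y, t, hyt⟩ := List.exists_cons_of_length_eq_add_one hlen
  obtain rfl : y = x := by simpa [hyt] using h0
  have hnd := Equiv.Perm.nodup_toList σ y
  have hf := formPerm_toList σ y
  rw [hyt] at hnd hlen
  rw [hyt, hcyc] at hf
  exact ⟨t, by simpa using hlen, hnd, hf⟩

theorem support_formPerm_cons {x : α} {t : List α} (ht : 1 ≤ t.length) (h : (x :: t).Nodup) :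
    (x :: t).formPerm.support = (x :: t).toFinset := by
  refine List.support_formPerm_of_nodup _ h fun y hy => ?_
  have := congrArg List.length hy
  simp only [List.length_cons, List.length_nil] at this
  omega

/-- Cycles of length `j + 1` with a marked point of the support correspond to lists of `j + 1`
different points. -/
theorem sum_cyclesOfLength_support {j : ℕ} (hj : 1 ≤ j) (H : Perm α → α → ℚ) :
    ∑ σ ∈ cyclesOfLength α (j + 1), ∑ x ∈ σ.support, H σ x =
      ∑ x, ∑ l : Fin j → α, if (x :: List.ofFn l).Nodup then
        H (x :: List.ofFn l).formPerm x else 0 := by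
  rw [← Fintype.sum_prod_type' (fun x (l : Fin j → α) => if (x :: List.ofFn l).Nodup then
        H (x :: List.ofFn l).formPerm x else 0), ← sum_filter, sum_sigma']
  symm
  refine sum_bij (fun p _ => ⟨(p.1 :: List.ofFn p.2).formPerm, p.1⟩) ?_ ?_ ?_ ?_
  · rintro ⟨x, l⟩ hp
    simp only [mem_filter, mem_univ, true_and] at hp
    have hs := support_formPerm_cons (by rwa [List.length_ofFn]) hp
    simp only [mem_sigma, mem_cyclesOfLength]
    refine ⟨⟨List.isCycle_formPerm hp (by simp; omega), ?_⟩, ?_⟩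
    · rw [hs, List.toFinset_card_of_nodup hp]
      simp
    · rw [hs]
      simp
  · rintro ⟨x, l⟩ hp ⟨x', l'⟩ hp' h
    simp only [mem_filter, mem_univ, true_and] at hp hp'
    simp only [Sigma.mk.injEq, heq_eq_eq] at h
    obtain ⟨h, rfl⟩ := h
    have h1 := toList_formPerm_nontrivial (x :: List.ofFn l) (by simp; omega) hp
    have h2 := toList_formPerm_nontrivial (x :: List.ofFn l') (by simp; omega) hp'
    rw [h] at h1
    have h3 := h1.symm.trans h2
    rw [List.cons.injEq] at h3
    rw [List.ofFn_injective h3.2]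
  · rintro ⟨σ, x⟩ hp
    simp only [mem_sigma, mem_cyclesOfLength] at hp
    obtain ⟨t, rfl, hnd, hf⟩ :=
      exists_formPerm_eq_of_mem_cyclesOfLength (mem_cyclesOfLength.mpr hp.1) hp.2
    refine ⟨(x, t.get), ?_, ?_⟩
    · simp only [List.ofFn_get, mem_filter, mem_univ, true_and]
      exact hnd
    · simp only [List.ofFn_get, hf]
  · rintro ⟨x, l⟩ _
    rfl

theorem card_cycleSets_le_mul_of_mem {j : ℕ} {σ : Perm α}
    (hσ : σ ∈ cyclesOfLength α (j + 1)) (π : Perm α) :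
    #(cycleSets π) ≤ #(cycleSets (π * σ)) + j := by
  obtain ⟨x, hx⟩ := (mem_cyclesOfLength.mp hσ).1.nonempty_support
  obtain ⟨t, rfl, -, rfl⟩ := exists_formPerm_eq_of_mem_cyclesOfLength hσ hx
  exact card_cycleSets_le_mul_formPerm π x t

/-- The product of the cycle lengths, summed over all ways to merge `j + 1` cycles of `π` by a
cycle of length `j + 1`. -/
theorem sum_cycleProd_mul_cycle {j : ℕ} (hj : 1 ≤ j) (π : Perm α) :
    ∑ σ ∈ cyclesOfLength α (j + 1),
        (if #(cycleSets (π * σ)) + j = #(cycleSets π) then cycleProd (π * σ) else 0) =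
      Fintype.card α * cycleProd π * ((#(cycleSets π) - 1).descFactorial j : ℕ) := by
  -- The length of the merged cycle is the sum of the lengths of its parts; marking a point of the
  -- support of `σ` selects one of the parts.
  have key : ∀ σ ∈ cyclesOfLength α (j + 1),
      (if #(cycleSets (π * σ)) + j = #(cycleSets π) then cycleProd (π * σ) else 0) =
        ∑ x ∈ σ.support, if #(cycleSets (π * σ)) + j = #(cycleSets π) then
          (#(cycleSet π x) : ℚ) * cycleProdErase (π * σ) x else 0 := by
    intro σ hσ
    split_ifs with h
    · obtain ⟨y, hy⟩ := (mem_cyclesOfLength.mp hσ).1.nonempty_support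
      obtain ⟨t, ht, hnd, hf⟩ := exists_formPerm_eq_of_mem_cyclesOfLength hσ hy
      have hm := merge_formPerm π y t (by rwa [hf, ht])
      have hs := support_formPerm_cons (by rwa [ht]) hnd
      rw [hf] at hm hs
      have hG : ∀ z ∈ σ.support, (#(cycleSet π z) : ℚ) * cycleProdErase (π * σ) z =
          (#(cycleSet π z) : ℚ) * cycleProdErase (π * σ) y := by
        intro z hz
        rw [hs, List.mem_toFinset, List.mem_cons] at hz
        rcases hz with rfl | hz
        · rfl
        · rw [cycleProdErase_congr (hm.2.2.1 z hz)]
      rw [sum_congr rfl hG, ← sum_mul, hs, List.sum_toFinset _ hnd,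
        ← card_mul_cycleProdErase (π * σ) y, hm.2.2.2.2]
      congr 1
      rw [Nat.cast_list_sum, List.map_map]
      rfl
    · simp
  rw [sum_congr rfl key, sum_cyclesOfLength_support hj]
  have key2 : ∀ x : α, (∑ l : Fin j → α, if (x :: List.ofFn l).Nodup then
      (if #(cycleSets (π * (x :: List.ofFn l).formPerm)) + j = #(cycleSets π) then
        (#(cycleSet π x) : ℚ) * cycleProdErase (π * (x :: List.ofFn l).formPerm) x else 0) else 0) =
      cycleProd π * ((#(cycleSets π) - 1).descFactorial j : ℕ) := by
    intro x
    rw [← card_mul_cycleProdErase π x, mul_assoc, ← sum_cycleProdErase_mul_formPerm, mul_sum]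
    refine sum_congr rfl fun l _ => ?_
    by_cases h : #(cycleSets (π * (x :: List.ofFn l).formPerm)) + j = #(cycleSets π)
    · have hm := merge_formPerm π x (List.ofFn l) (by rwa [List.length_ofFn])
      rw [if_pos hm.1, if_pos h, if_pos h]
    · rw [if_neg h, if_neg h, mul_zero, ite_self]
  rw [sum_congr rfl fun x _ => key2 x, sum_const, card_univ, nsmul_eq_mul, mul_assoc]

end Lists

section Tuples

variable {α : Type*} [Fintype α] [DecidableEq α]

/-! ### Tuples of cycles -/

theorem card_cycleSets_le_mul_prod_ofFn {n : ℕ} {j : Fin n → ℕ} {σ : Fin n → Perm α}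
    (hσ : ∀ i, σ i ∈ cyclesOfLength α (j i + 1)) (π : Perm α) :
    #(cycleSets π) ≤ #(cycleSets (π * (List.ofFn σ).prod)) + ∑ i, j i := by
  induction n generalizing π with
  | zero => simp
  | succ n ih =>
    rw [List.ofFn_succ, List.prod_cons, ← mul_assoc, Fin.sum_univ_succ]
    have h1 := ih (fun i => hσ i.succ) (π * σ 0)
    have h2 := card_cycleSets_le_mul_of_mem (hσ 0) π
    omega

/-- The number of ways to merge all cycles of `π` to a single one by multiplication with cycles of
given lengths `j i + 1`, when there are just enough of these to do so. -/
theorem sum_mul_prod_ofFn {n : ℕ} (j : Fin n → ℕ) (hj : ∀ i, 1 ≤ j i) (π : Perm α)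
    (hπ : #(cycleSets π) = 1 + ∑ i, j i) :
    (Fintype.card α : ℚ) * ∑ σ : Fin n → Perm α,
        (if (∀ i, σ i ∈ cyclesOfLength α (j i + 1)) ∧
          #(cycleSets (π * (List.ofFn σ).prod)) = 1 then 1 else 0) =
      cycleProd π * (Fintype.card α : ℚ) ^ n * ((#(cycleSets π) - 1)! : ℕ) := by
  induction n generalizing π with
  | zero =>
    have h1 : #(cycleSets π) = 1 := by simpa using hπ
    simp [h1, cycleProd_of_card_cycleSets_eq_one h1]
  | succ n ih =>
    rw [Fin.sum_univ_succ] at hπ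
    set k := ∑ i : Fin n, j i.succ with hk
    rw [← (Fin.consEquiv fun _ : Fin (n + 1) => Perm α).sum_comp, Fintype.sum_prod_type]
    have key : ∀ τ : Perm α, (Fintype.card α : ℚ) * (∑ σ : Fin n → Perm α,
        (if (∀ i, Fin.consEquiv (fun _ : Fin (n + 1) => Perm α) (τ, σ) i ∈
            cyclesOfLength α (j i + 1)) ∧ #(cycleSets (π * (List.ofFn (Fin.consEquiv
              (fun _ : Fin (n + 1) => Perm α) (τ, σ))).prod)) = 1 then (1 : ℚ) else 0)) =
        if τ ∈ cyclesOfLength α (j 0 + 1) then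
          (if #(cycleSets (π * τ)) + j 0 = #(cycleSets π) then cycleProd (π * τ) else 0) *
            ((Fintype.card α : ℚ) ^ n * (k ! : ℕ)) else 0 := by
      intro τ
      have e : ∀ σ : Fin n → Perm α, Fin.consEquiv (fun _ : Fin (n + 1) => Perm α) (τ, σ) =
          Fin.cons τ σ := fun σ => rfl
      have e' : ∀ σ : Fin n → Perm α, π * (List.ofFn (Fin.cons τ σ : Fin (n + 1) → Perm α)).prod =
          π * τ * (List.ofFn σ).prod := fun σ => by
        rw [List.ofFn_succ, List.prod_cons, ← mul_assoc]
        simp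
      simp only [e, e', Fin.forall_fin_succ, Fin.cons_zero, Fin.cons_succ]
      by_cases hτ : τ ∈ cyclesOfLength α (j 0 + 1)
      · rw [if_pos hτ]
        simp only [hτ, true_and]
        split_ifs with h
        · have h2 : #(cycleSets (π * τ)) = 1 + k := by omega
          rw [ih (fun i => j i.succ) (fun i => hj i.succ) (π * τ) h2, h2, Nat.add_sub_cancel_left,
            mul_assoc]
        · -- Too few cycles have been merged by `τ`.
          rw [zero_mul]
          refine mul_eq_zero_of_right _ (sum_eq_zero fun σ _ => if_neg fun hc => ?_)
          have h1 := card_cycleSets_le_mul_prod_ofFn hc.1 (π * τ)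
          have h2 := card_cycleSets_le_mul_of_mem hτ π
          omega
      · simp [hτ]
    rw [mul_sum, sum_congr rfl fun τ _ => key τ, ← sum_filter, filter_mem_eq_inter, univ_inter,
      ← sum_mul, sum_cycleProd_mul_cycle (hj 0)]
    have hf : k ! * (#(cycleSets π) - 1).descFactorial (j 0) = (#(cycleSets π) - 1)! := by
      rw [← Nat.factorial_mul_descFactorial (show j 0 ≤ #(cycleSets π) - 1 by omega)]
      congr 2
      omega
    rw [← hf]
    push_cast
    ring

/-! ### Hurwitz factorizations -/

theorem partition_parts_eq_iff {σ : Perm α} {e : ℕ} (he : 2 ≤ e) :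
    σ.partition.parts = e ::ₘ Multiset.replicate (Fintype.card α - e) 1 ↔
      σ ∈ cyclesOfLength α e := by
  rw [mem_cyclesOfLength]
  constructor
  · intro h
    have hc : σ.cycleType = {e} := by
      rw [← filter_parts_partition_eq_cycleType, h, Multiset.filter_cons_of_pos _ he,
        Multiset.filter_eq_nil.mpr fun a ha => by rw [Multiset.eq_of_mem_replicate ha]; omega]
      rfl
    refine ⟨card_cycleType_eq_one.mp (by rw [hc, Multiset.card_singleton]), ?_⟩
    rw [← sum_cycleType, hc, Multiset.sum_singleton]
  · rintro ⟨hc, rfl⟩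
    rw [parts_partition, hc.cycleType, Multiset.singleton_add]

theorem mem_cyclesOfLength_card_iff (hα : 2 ≤ Fintype.card α) {σ : Perm α} :
    σ ∈ cyclesOfLength α (Fintype.card α) ↔ #(cycleSets σ) = 1 := by
  have : Nonempty α := Fintype.card_pos_iff.mp (by omega)
  have : Nontrivial α := Fintype.one_lt_card_iff_nontrivial.mp (by omega)
  rw [mem_cyclesOfLength, card_cycleSets_eq_one_iff]
  constructor
  · rintro ⟨hc, hs⟩ x y
    rw [card_eq_iff_eq_univ] at hs
    exact hc.sameCycle (mem_support.mp (hs ▸ mem_univ x)) (mem_support.mp (hs ▸ mem_univ y))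
  · intro h
    have hne : ∀ x, σ x ≠ x := by
      intro x hx
      obtain ⟨y, hy⟩ := exists_ne x
      exact hy ((h x y).eq_of_left hx).symm
    refine ⟨?_, ?_⟩
    · obtain ⟨x⟩ := ‹Nonempty α›
      exact ⟨x, hne x, fun y _ => h x y⟩
    · rw [card_eq_iff_eq_univ]
      ext x
      simp [hne x]

theorem inv_mem_cyclesOfLength {σ : Perm α} {e : ℕ} :
    σ⁻¹ ∈ cyclesOfLength α e ↔ σ ∈ cyclesOfLength α e := by
  rw [mem_cyclesOfLength, mem_cyclesOfLength, isCycle_inv, support_inv]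

end Tuples

theorem isPretransitive_closure {α : Type*} {S : Set (Perm α)} {σ : Perm α} (hσ : σ ∈ S)
    (h : ∀ x y, σ.SameCycle x y) : MulAction.IsPretransitive (Subgroup.closure S) α := by
  refine ⟨fun x y => ?_⟩
  obtain ⟨i, hi⟩ := h x y
  exact ⟨⟨σ ^ i, zpow_mem (Subgroup.subset_closure hσ) i⟩, hi⟩


theorem partitionIndex_pureCyclePartition {d e : ℕ} (he : 2 ≤ e ∧ e ≤ d) :
    partitionIndex (pureCyclePartition d e he) = e - 1 := by
  simp [partitionIndex, pureCyclePartition]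

/-- In genus `0`, if the last partition is `(d)`, then a Hurwitz factorization is determined by its
other factors, and these are arbitrary cycles of the given lengths whose product is a `d`-cycle. -/
theorem isHurwitzFactorization_pureCycle_iff {d n : ℕ} {e : Fin (n + 1) → ℕ}
    (he : ∀ i, 2 ≤ e i ∧ e i ≤ d) (hlast : e (Fin.last n) = d)
    (hsum : ∑ i : Fin n, (e i.castSucc - 1) = d - 1) (σ : Fin (n + 1) → Perm (Fin d)) :
    IsHurwitzFactorization d (n + 1) 0 (fun i => pureCyclePartition d (e i) (he i)) σ ↔
      ((∀ i : Fin n, σ i.castSucc ∈ cyclesOfLength (Fin d) (e i.castSucc)) ∧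
        #(cycleSets (List.ofFn fun i : Fin n => σ i.castSucc).prod) = 1) ∧
      σ (Fin.last n) = (List.ofFn fun i : Fin n => σ i.castSucc).prod⁻¹ := by
  have hd : 2 ≤ Fintype.card (Fin d) := by
    rw [Fintype.card_fin]
    exact (he 0).1.trans (he 0).2
  have hpart : ∀ i (τ : Perm (Fin d)), τ.partition.parts =
      (pureCyclePartition d (e i) (he i)).parts ↔ τ ∈ cyclesOfLength (Fin d) (e i) := by
    intro i τ
    have hparts : (pureCyclePartition d (e i) (he i)).parts =
        e i ::ₘ Multiset.replicate (Fintype.card (Fin d) - e i) 1 := by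
      rw [Fintype.card_fin]
      rfl
    rw [hparts]
    exact partition_parts_eq_iff (he i).1
  have hprod : (List.ofFn σ).prod =
      (List.ofFn fun i : Fin n => σ i.castSucc).prod * σ (Fin.last n) := by
    rw [List.ofFn_succ', List.concat_eq_append, List.prod_append, List.prod_singleton]
  have hdlast : ∀ τ : Perm (Fin d),
      τ⁻¹ ∈ cyclesOfLength (Fin d) (e (Fin.last n)) ↔ #(cycleSets τ) = 1 := by
    intro τ
    rw [inv_mem_cyclesOfLength, ← mem_cyclesOfLength_card_iff hd, hlast, Fintype.card_fin]
  constructor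
  · rintro ⟨-, hct, hp, -⟩
    rw [hprod, mul_eq_one_iff_eq_inv'] at hp
    have hl := (hpart _ _).mp (hct (Fin.last n))
    rw [hp, hdlast] at hl
    exact ⟨⟨fun i => (hpart _ _).mp (hct i.castSucc), hl⟩, hp⟩
  · rintro ⟨⟨hc, h1⟩, hl⟩
    refine ⟨?_, ?_, ?_, ?_⟩
    · simp only [partitionIndex_pureCyclePartition]
      rw [← Nat.cast_sum, Fin.sum_univ_castSucc, hsum, hlast]
      rw [Fintype.card_fin] at hd
      push_cast [Nat.cast_sub (show 1 ≤ d by omega)]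
      ring
    · intro i
      rw [hpart]
      induction i using Fin.lastCases with
      | last => rw [hl, hdlast]; exact h1
      | cast i => exact hc i
    · rw [hprod, hl, mul_inv_cancel]
    · have : Nonempty (Fin d) := Fintype.card_pos_iff.mp (by omega)
      refine isPretransitive_closure (σ := σ (Fin.last n)) ⟨_, rfl⟩ fun x y => ?_
      rw [hl, sameCycle_inv]
      exact card_cycleSets_eq_one_iff.mp h1 x y

theorem card_isHurwitzFactorization_pureCycle {d n : ℕ} {e : Fin (n + 1) → ℕ}
    (he : ∀ i, 2 ≤ e i ∧ e i ≤ d) (hlast : e (Fin.last n) = d)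
    (hsum : ∑ i : Fin n, (e i.castSucc - 1) = d - 1) :
    Nat.card {σ : Fin (n + 1) → Perm (Fin d) // IsHurwitzFactorization d (n + 1) 0
        (fun i => pureCyclePartition d (e i) (he i)) σ} =
      #{σ : Fin n → Perm (Fin d) | (∀ i, σ i ∈ cyclesOfLength (Fin d) (e i.castSucc)) ∧
        #(cycleSets (List.ofFn σ).prod) = 1} := by
  have hiff := isHurwitzFactorization_pureCycle_iff he hlast hsum
  rw [← Nat.card_eq_finsetCard]
  refine Nat.card_congr
    { toFun := fun σ => ⟨fun i => σ.1 i.castSucc, by simpa using ((hiff σ.1).mp σ.2).1⟩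
      invFun := fun τ => ⟨Fin.snoc τ.1 (List.ofFn τ.1).prod⁻¹, by
        rw [hiff]
        simpa using (mem_filter.mp τ.2).2⟩
      left_inv := fun σ => ?_
      right_inv := fun τ => ?_ }
  · refine Subtype.ext (funext fun i => ?_)
    induction i using Fin.lastCases with
    | last => simp [((hiff σ.1).mp σ.2).2]
    | cast i => simp
  · exact Subtype.ext (funext fun i => by simp)

theorem theorem1p1 (d n : ℕ) (e : Fin (n + 1) → ℕ) (he : ∀ i, 2 ≤ e i ∧ e i ≤ d)
    (hlast : e (Fin.last n) = d)
    (hsum : ∑ i : Fin n, (e i.castSucc - 1) = d - 1) :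
    pureCycleHurwitzNumber d (n + 1) 0 e he = (d : ℚ) ^ (((n + 1 : ℕ) : ℤ) - 3) := by
  have hd : 2 ≤ d := (he 0).1.trans (he 0).2
  have hd0 : (d : ℚ) ≠ 0 := by
    rw [Nat.cast_ne_zero]
    omega
  have hmain := sum_mul_prod_ofFn (α := Fin d) (fun i : Fin n => e i.castSucc - 1)
    (fun i => by have := (he i.castSucc).1; omega) 1
    (by rw [card_cycleSets_one, Fintype.card_fin, hsum]; omega)
  have hsub : ∀ i : Fin n, e i.castSucc - 1 + 1 = e i.castSucc := fun i => by
    have := (he i.castSucc).1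
    omega
  simp only [one_mul, hsub, card_cycleSets_one, cycleProd_one, Fintype.card_fin] at hmain
  rw [sum_boole] at hmain
  rw [pureCycleHurwitzNumber, hurwitzNumber, card_isHurwitzFactorization_pureCycle he hlast hsum]
  have hfac : (d ! : ℚ) = d * ((d - 1)! : ℕ) := by
    rw [← Nat.mul_factorial_pred (by omega : d ≠ 0)]
    push_cast
    rfl
  have hf0 : (((d - 1)! : ℕ) : ℚ) ≠ 0 := Nat.cast_ne_zero.mpr (Nat.factorial_ne_zero _)
  have hexp : (((n + 1 : ℕ) : ℤ) - 3) = (n : ℤ) - 2 := by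
    push_cast
    ring
  rw [hexp, zpow_sub₀ hd0, zpow_natCast, hfac, div_eq_div_iff (by positivity) (by positivity)]
  have h2 : (d : ℚ) ^ (2 : ℤ) = d * d := by
    rw [← pow_two]
    norm_cast
  rw [h2, mul_left_comm, ← mul_assoc, mul_comm (_ : ℚ) (d : ℚ), hmain]
  ring
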